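/- Let $\Phi_c$ be the set of all functions $\varphi:[0,\infty)\to[0,\infty]$ that are non-decreasing, convex and left-continuous with $\varphi(0)=\lim_{t\to0^+}\varphi(t)=0$ and $\lim_{t\to\infty}\varphi(t)=\infty$. For $I=[a,b]$ with $a<b$ and $f:I\to\mathbb R$ define the Riesz $\varphi$-variation $$V^\varphi_I(f):=\sup_{a=x_0<x_1<\dots<x_n=b}\ \sum_{k=1}^{n}\varphi\Big(\frac{|f(x_k)-f(x_{k-1})|}{x_k-x_{k-1}}\Big)(x_k-x_{k-1})\in[0,\infty].$$ For a left-continuous function $f:I\to\mathbb R$ of bounded variation, let $Df$ be the finite signed Borel measure on $I$ with $Df([a,x))=f(x)-f(a)$ for all $x\in I$ and $Df(\{b\})=0$ (so that a jump of $f$ at $a$ is an atom of $Df$). Write $Df=f'\,dx+D^sf$ for its Lebesgue decomposition with respect to Lebesgue measure, and let $|D^sf|$ be the total variation measure of $D^sf$. **Corollary 1.4.** Let $\varphi\in\Phi_c$. Then the limit $K:=\lim_{t\to\infty}\varphi(t)/t\in[0,\infty]$ exists. Let $I=[a,b]$ with $a<b$ and let $f:I\to\mathbb R$ satisfy $V^\varphi_I(f)<\infty$.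 1. If $K<\infty$ and $f$ is left-continuous, then $f$ is of bounded variation on $I$ and $$V^\varphi_I(f)=\int_I\varphi(|f'|)\,dx+K\,|D^sf|(I).$$ 2. If $K=\infty$, then $f$ is absolutely continuous on $I$ and $$V^\varphi_I(f)=\int_I\varphi(|f'|)\,dx,$$ where $f'$ is the almost everywhere existing derivative of $f$. Moreover, the following question of Appell, Banaś and Merentes has a negative answer: if $p>1$ and $\varphi\in\Phi_c$ does not satisfy $\lim_{t\to\infty}\varphi(t)/t^p=\infty$, do $V^\varphi_I$ and $V^p_I$ (the case $t\mapsto t^p$) generate the same space? Here the space generated by $V^\varphi_I$ is $\mathrm{RBV}^\varphi(I)=\{f:I\to\mathbb R : \lim_{\lambda\to0}V^\varphi_I(\lambda f)=0\}$. Indeed, there is $\varphi\in\Phi_c$ such that, for every $p>1$, it is not the case that $\lim_{t\to\infty}\varphi(t)/t^p=\infty$, and $\mathrm{RBV}^\varphi(I)\neq\mathrm{RBV}^{p}(I)$ for every $I=[a,b]$ with $a<b$. -/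

import Mathlib

open Set Filter Topology MeasureTheory
open scoped NNReal ENNReal

/-- A weak `Φ`-function that does not depend on the space variable, `φ : [0, ∞) → [0, ∞]`.
Measurability of `φ ∘ g` for measurable `g` is automatic, since `φ` is monotone. -/
structure IsWeakPhi (φ : ℝ≥0 → ℝ≥0∞) : Prop where
  mono : Monotone φ
  map_zero : φ 0 = 0
  tendsto_zero : Tendsto φ (𝓝[>] 0) (𝓝 0)
  tendsto_atTop : Tendsto φ atTop (𝓝 ∞)
  almost_increasing :
    ∃ L : ℝ≥0, 1 ≤ L ∧ ∀ s t : ℝ≥0, 0 < s → s < t → φ s / s ≤ L * (φ t / t)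

/-- A convex `Φ`-function that does not depend on the space variable (the class `Φ_c`). -/
structure IsConvexPhi (φ : ℝ≥0 → ℝ≥0∞) : Prop extends IsWeakPhi φ where
  convex : ConvexOn ℝ≥0 univ φ
  left_continuous : ∀ t, ContinuousWithinAt φ (Iic t) t

/-- The points `u 0 < u 1 < ⋯ < u n` are the end points of a partition of `[a, b]` into the `n`
non-degenerate closed intervals `[u i, u (i + 1)]`, `i < n`. -/
def IsPartition (a b : ℝ) (n : ℕ) (u : ℕ → ℝ) : Prop :=
  u 0 = a ∧ u n = b ∧ ∀ i < n, u i < u (i + 1)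

/-- The sum `∑ φ(|Δₖ f| / |Iₖ|) |Iₖ|` over the intervals `Iₖ = [u k, u (k + 1)]`. -/
noncomputable def rieszSum (φ : ℝ≥0 → ℝ≥0∞) (f : ℝ → ℝ) (n : ℕ) (u : ℕ → ℝ) : ℝ≥0∞ :=
  ∑ i ∈ Finset.range n,
    φ ‖(f (u (i + 1)) - f (u i)) / (u (i + 1) - u i)‖₊ * ENNReal.ofReal (u (i + 1) - u i)

/-- The Riesz `φ`-variation on `I = [a, b]`. Only the values of `f` on `[a, b]` matter. -/
noncomputable def rieszVariation (φ : ℝ≥0 → ℝ≥0∞) (a b : ℝ) (f : ℝ → ℝ) : ℝ≥0∞ :=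
  ⨆ (n : ℕ) (u : ℕ → ℝ) (_ : IsPartition a b n u), rieszSum φ f n u

/-- The function which agrees with `f` on `[a, b]` and is constant on either side. -/
def clampExtend (f : ℝ → ℝ) (a b : ℝ) (x : ℝ) : ℝ := f (max a (min x b))

theorem clampExtend_boundedVariationOn {f : ℝ → ℝ} {a b : ℝ} (hab : a ≤ b)
    (hf : BoundedVariationOn f (Icc a b)) : BoundedVariationOn (clampExtend f a b) univ := by
  have hm : MonotoneOn (fun x : ℝ => max a (min x b)) univ := fun x _ y _ hxy =>
    max_le_max le_rfl (min_le_min hxy le_rfl)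
  have hs : MapsTo (fun x : ℝ => max a (min x b)) univ (Icc a b) := fun x _ =>
    ⟨le_max_left _ _, max_le hab (min_le_right _ _)⟩
  exact ne_top_of_le_ne_top hf (eVariationOn.comp_le_of_monotoneOn f _ hm hs)

/-- The derivative measure `Df` of a function of bounded variation on `[a, b]`. It is carried by
`[a, b]`, and for left-continuous `f` it is characterized by `Df [a, x) = f x - f a`
for `x ∈ [a, b]` (and no mass at `b`); a jump of `f` at the end point `a` is an atom of `Df`. -/
noncomputable def derivMeasure {f : ℝ → ℝ} {a b : ℝ} (hab : a ≤ b)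
    (hf : BoundedVariationOn f (Icc a b)) : SignedMeasure ℝ :=
  (clampExtend_boundedVariationOn hab hf).vectorMeasure

/-- Left-continuity of a function on `[a, b]` (no condition at `a`). -/
def IsLeftContinuousOn (f : ℝ → ℝ) (a b : ℝ) : Prop :=
  ∀ x ∈ Icc a b, ContinuousWithinAt f (Icc a x) x

theorem clampExtend_leftLim {f : ℝ → ℝ} {a b : ℝ} (hl : IsLeftContinuousOn f a b)
    {x : ℝ} (hx : x ∈ Icc a b) : (clampExtend f a b).leftLim x = f x := by
  have hc : clampExtend f a b x = f x := by simp [clampExtend, hx.1, hx.2]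
  rw [← hc]
  apply ContinuousWithinAt.leftLim_eq
  have hp : max a (min x b) = x := by simp [hx.1, hx.2]
  have h1 : ContinuousWithinAt (fun y : ℝ => max a (min y b)) (Iic x) x := by fun_prop
  have h2 : ContinuousWithinAt f (Icc a x) (max a (min x b)) := by rw [hp]; exact hl x hx
  have h3 : MapsTo (fun y : ℝ => max a (min y b)) (Iic x) (Icc a x) := fun y hy =>
    ⟨le_max_left _ _, max_le hx.1 ((min_le_left _ _).trans hy)⟩
  exact ContinuousWithinAt.comp (g := f) (f := fun y : ℝ => max a (min y b)) h2 h1 h3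

theorem derivMeasure_Ico {f : ℝ → ℝ} {a b : ℝ} (hab : a ≤ b)
    (hf : BoundedVariationOn f (Icc a b)) (hl : IsLeftContinuousOn f a b)
    {x y : ℝ} (hx : x ∈ Icc a b) (hy : y ∈ Icc a b) (hxy : x ≤ y) :
    derivMeasure hab hf (Ico x y) = f y - f x := by
  rw [derivMeasure, BoundedVariationOn.vectorMeasure_Ico _ hxy, clampExtend_leftLim hl hy,
    clampExtend_leftLim hl hx]

/-- The density `f'` of the absolutely continuous part of `Df`. -/
noncomputable def acDensity {f : ℝ → ℝ} {a b : ℝ} (hab : a ≤ b)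
    (hf : BoundedVariationOn f (Icc a b)) : ℝ → ℝ :=
  (derivMeasure hab hf).rnDeriv volume

/-- The total variation measure `|Dˢf|` of the singular part of `Df`. -/
noncomputable def singularVariation {f : ℝ → ℝ} {a b : ℝ} (hab : a ≤ b)
    (hf : BoundedVariationOn f (Icc a b)) : Measure ℝ :=
  ((derivMeasure hab hf).singularPart volume).totalVariation

/-- The modular `∫_{[a, b]} φ(|g|) dx`. -/
noncomputable def orliczModular (φ : ℝ≥0 → ℝ≥0∞) (a b : ℝ) (g : ℝ → ℝ) : ℝ≥0∞ :=
  ∫⁻ x in Icc a b, φ ‖g x‖₊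

/-- The space of functions of bounded `φ`-variation in the sense of Riesz on `[a, b]`. -/
def RBV (φ : ℝ≥0 → ℝ≥0∞) (a b : ℝ) : Set (ℝ → ℝ) :=
  {f | Tendsto (fun c : ℝ => rieszVariation φ a b (c • f)) (𝓝[≠] 0) (𝓝 0)}

/-- The function `t ↦ t ^ p`. -/
noncomputable def powPhi (p : ℝ) : ℝ≥0 → ℝ≥0∞ := fun t => (t : ℝ≥0∞) ^ p

/-- The class of all `φ ∈ Φ_c` with `φ(t) / t ^ p → ∞` as `t → ∞`. -/
def inftyClass (p : ℝ) : Set (ℝ≥0 → ℝ≥0∞) :=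
  {φ | IsConvexPhi φ ∧ Tendsto (fun t : ℝ≥0 => φ t / powPhi p t) atTop (𝓝 ∞)}

/-!
A convex `Φ`-function is the supremum of its affine minorants `t ↦ α t - β` with `α, β ≥ 0`, and
`K = lim φ t / t` is the supremum of their slopes. Each minorant turns the formula for the
variation into a linear statement about measures.

Lower bound. The function `G x = V_[a, x](f)` is monotone and, since an interval can be appended to
a partition, `α |f y - f x| ≤ G y - G x + β (y - x)` for every minorant
(`IsAffineMinorant.mul_abs_sub_le`). In particular `f` has bounded variation, and the Stieltjes
measure `ν` of `G`, whose mass is at most `V`, satisfies `α |Df| ≤ ν + β dx`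
(`BoundedVariationOn.smul_totalVariation_vectorMeasure_le`). Comparing densities and taking the
supremum over countably many minorants gives `φ(|f'|) ≤ dν/dx` almost everywhere; comparing on a
Lebesgue null set that carries `Dˢf`, where the term `β dx` vanishes, gives `K |Dˢf| ≤ ν` there.
Adding the two yields `∫ φ(|f'|) + K |Dˢf| ≤ V` (`IsConvexPhi.lintegral_add_le`).

Upper bound. On one interval, integrating `α |f'| ≤ φ(|f'|) + β` and using `α ≤ K` bounds each
minorant of `φ(|Δf| / |I|) |I|` by `∫_I φ(|f'|) + K |Dˢf|(I)`; the right hand side is additive over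
the partition (`IsConvexPhi.apply_mul_ofReal_le`).

All this is valid for `K = ∞` as well, with `∞ * 0 = 0`. In that case minorants of arbitrarily large
slope make `f` continuous from the left, and finiteness of `∞ * |Dˢf|` forces `Dˢf = 0`. So `f` is
the integral of the density of `Df`, which is therefore almost everywhere the derivative of `f`.

For the question of Appell, Banaś and Merentes take `φ t = t`: a function with a single jump has
variation tending to `0` for `φ` as it is rescaled by `c → 0`, whereas its variation for `t ↦ t ^ p`
is at least `1` for every `c ≠ 0`.
-/

/-! ### Affine minorants of convex `Φ`-functions -/


/-- The affine function `x ↦ α x - β` is a minorant of `φ`. The intercept is moved to the right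
hand side to avoid truncated subtraction. -/
def IsAffineMinorant (φ : ℝ≥0 → ℝ≥0∞) (α β : ℝ≥0) : Prop :=
  ∀ x : ℝ≥0, (α : ℝ≥0∞) * x ≤ φ x + β

namespace IsConvexPhi

variable {φ : ℝ≥0 → ℝ≥0∞}

theorem exists_lt_lt_apply (hφ : IsConvexPhi φ) {t : ℝ≥0} {c : ℝ≥0∞} (hc : c < φ t) :
    ∃ s < t, c < φ s := by
  have ht : 0 < t := by
    rcases eq_zero_or_pos t with rfl | h
    · simp [hφ.map_zero] at hc
    · exact h
  have h1 : ∀ᶠ s in 𝓝[<] t, c < φ s :=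
    ((hφ.left_continuous t).mono Iio_subset_Iic_self).eventually (lt_mem_nhds hc)
  have : (𝓝[<] t).NeBot := nhdsLT_neBot_of_exists_lt ⟨0, ht⟩
  obtain ⟨s, hs, hst⟩ := (h1.and self_mem_nhdsWithin).exists
  exact ⟨s, hst, hs⟩

/-- Convexity with the weights cleared of denominators. -/
theorem mul_apply_le (hφ : IsConvexPhi φ) {x y z : ℝ≥0} (hxy : x < y) (hyz : y < z) :
    ((z - x : ℝ≥0) : ℝ≥0∞) * φ y ≤ (z - y : ℝ≥0) * φ x + (y - x : ℝ≥0) * φ z := by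
  have hxz := hxy.trans hyz
  have hne : z - x ≠ 0 := (tsub_pos_of_lt hxz).ne'
  have hsum : (z - y) / (z - x) + (y - x) / (z - x) = 1 := by
    rw [← add_div, div_eq_one_iff_eq hne]
    exact tsub_add_tsub_cancel hyz.le hxy.le
  have h := hφ.convex.2 (mem_univ x) (mem_univ z) (zero_le : 0 ≤ (z - y) / (z - x))
    (zero_le : 0 ≤ (y - x) / (z - x)) hsum
  have hy : ((z - y) / (z - x)) • x + ((y - x) / (z - x)) • z = y := by
    rw [← NNReal.coe_inj]
    have h0 : (z : ℝ) - x ≠ 0 := by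
      have : (x : ℝ) < z := by exact_mod_cast hxz
      linarith
    push_cast [smul_eq_mul, NNReal.coe_sub hyz.le, NNReal.coe_sub hxz.le, NNReal.coe_sub hxy.le]
    field_simp
    ring
  rw [hy] at h
  calc ((z - x : ℝ≥0) : ℝ≥0∞) * φ y
      ≤ ((z - x : ℝ≥0) : ℝ≥0∞) * (((z - y) / (z - x)) • φ x + ((y - x) / (z - x)) • φ z) := by
        gcongr
    _ = _ := by
        rw [mul_add, ENNReal.smul_def, ENNReal.smul_def, smul_eq_mul, smul_eq_mul, ← mul_assoc,
          ← mul_assoc, ← ENNReal.coe_mul, ← ENNReal.coe_mul, mul_div_cancel₀ _ hne,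
          mul_div_cancel₀ _ hne]

/-- A convex `Φ`-function is the supremum of its affine minorants. If `φ s < ∞` for some `s < t`
close to `t`, the minorant is the line through `(s, φ r)` of slope `(φ s - φ r) / (s - r)`, for
some `r < s`; otherwise any sufficiently steep line vanishing at some `s < t` with `φ s = ∞` will do. -/
theorem exists_isAffineMinorant (hφ : IsConvexPhi φ) {t : ℝ≥0} {c : ℝ≥0∞} (hc : c < φ t) :
    ∃ α β : ℝ≥0, IsAffineMinorant φ α β ∧ c + β < α * t := by
  obtain ⟨s, hst, hs⟩ := hφ.exists_lt_lt_apply hc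
  lift c to ℝ≥0 using hc.ne_top
  by_cases hfin : φ s = ∞
  · have hne : t - s ≠ 0 := (tsub_pos_of_lt hst).ne'
    refine ⟨(c + 1) / (t - s), (c + 1) / (t - s) * s, fun x => ?_, ?_⟩
    · rcases le_total x s with hx | hx
      · refine le_add_left ?_
        rw [← ENNReal.coe_mul]
        exact_mod_cast mul_le_mul_right hx _
      · have : φ x = ∞ := top_le_iff.1 (hfin ▸ hφ.mono hx)
        simp [this]
    · rw [← ENNReal.coe_mul, ← ENNReal.coe_add, ENNReal.coe_lt_coe]
      have : (c + 1) / (t - s) * t = (c + 1) + (c + 1) / (t - s) * s := by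
        conv_lhs => rw [← div_mul_cancel₀ (c + 1) hne]
        nth_rw 2 [← div_mul_cancel₀ (c + 1) hne]
        rw [mul_div_cancel_right₀ _ hne, ← mul_add, tsub_add_cancel_of_le hst.le]
      rw [this]
      gcongr
      simp
  · obtain ⟨r, hrs, hr⟩ := hφ.exists_lt_lt_apply hs
    obtain ⟨S, hS⟩ : ∃ S : ℝ≥0, (S : ℝ≥0∞) = φ s := ⟨_, ENNReal.coe_toNNReal hfin⟩
    obtain ⟨R, hR⟩ : ∃ R : ℝ≥0, (R : ℝ≥0∞) = φ r :=
      ⟨_, ENNReal.coe_toNNReal (ne_top_of_le_ne_top hfin (hφ.mono hrs.le))⟩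
    have hRS : R ≤ S := by
      have := hφ.mono hrs.le
      rw [← hS, ← hR] at this
      exact_mod_cast this
    rw [← hR, ENNReal.coe_lt_coe] at hr
    have hrs' : (0 : ℝ) < s - r := by
      have : (r : ℝ) < s := by exact_mod_cast hrs
      linarith
    have hα0 : 0 ≤ ((S : ℝ) - R) / (s - r) := by
      have : (R : ℝ) ≤ S := by exact_mod_cast hRS
      have : (0 : ℝ) ≤ S - R := by linarith
      positivity
    obtain ⟨α, hα⟩ : ∃ α : ℝ≥0, (α : ℝ) = ((S : ℝ) - R) / (s - r) := ⟨⟨_, hα0⟩, rfl⟩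
    have hαm : (α : ℝ) * (s - r) = S - R := by rw [hα]; field_simp
    have key : ∀ x X : ℝ≥0, (X : ℝ≥0∞) = φ x → (α : ℝ) * x + R ≤ X + α * s := by
      intro x X hX
      rcases lt_or_ge x r with hx | hx
      · have h := hφ.mul_apply_le hx hrs
        rw [← hX, ← hS, ← hR] at h
        norm_cast at h
        have h' : ((s - x : ℝ≥0) : ℝ) * R ≤ (s - r : ℝ≥0) * X + (r - x : ℝ≥0) * S := by
          exact_mod_cast h
        rw [NNReal.coe_sub hrs.le, NNReal.coe_sub (hx.trans hrs).le, NNReal.coe_sub hx.le] at h'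
        have hxr : (x : ℝ) < r := by exact_mod_cast hx
        have h2 : ((s : ℝ) - r) * (R - X) ≤ (s - r) * (α * (r - x)) := by nlinarith
        have h3 := le_of_mul_le_mul_left h2 hrs'
        have h4 : (α : ℝ) * r ≤ α * s := by
          have : 0 ≤ (α : ℝ) := α.2
          nlinarith
        linarith
      · have hRX : (R : ℝ) ≤ X := by
          have := hφ.mono hx
          rw [← hX, ← hR] at this
          exact_mod_cast this
        rcases le_or_gt x s with hxs | hxs
        · have : (x : ℝ) ≤ s := by exact_mod_cast hxs
          have : (α : ℝ) * x ≤ α * s := by gcongr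
          linarith
        · have h := hφ.mul_apply_le hrs hxs
          rw [← hX, ← hS, ← hR] at h
          norm_cast at h
          have h' : ((x - r : ℝ≥0) : ℝ) * S ≤ (x - s : ℝ≥0) * R + (s - r : ℝ≥0) * X := by
            exact_mod_cast h
          rw [NNReal.coe_sub hrs.le, NNReal.coe_sub (hrs.trans hxs).le,
            NNReal.coe_sub hxs.le] at h'
          have hsx : (s : ℝ) < x := by exact_mod_cast hxs
          have h2 : ((s : ℝ) - r) * (α * (x - s)) ≤ (s - r) * (X - S) := by nlinarith
          have h3 := le_of_mul_le_mul_left h2 hrs'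
          have : (R : ℝ) ≤ S := by exact_mod_cast hRS
          linarith
    have hβ : R ≤ α * s := by
      have := key 0 0 (by simp [hφ.map_zero])
      simp only [NNReal.coe_zero, mul_zero, zero_add] at this
      exact_mod_cast this
    refine ⟨α, α * s - R, fun x => ?_, ?_⟩
    · by_cases hx : φ x = ∞
      · simp [hx]
      · obtain ⟨X, hX⟩ : ∃ X : ℝ≥0, (X : ℝ≥0∞) = φ x := ⟨_, ENNReal.coe_toNNReal hx⟩
        rw [← hX, ← ENNReal.coe_mul, ← ENNReal.coe_add, ENNReal.coe_le_coe, ← NNReal.coe_le_coe]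
        push_cast [NNReal.coe_sub hβ]
        linarith [key x X hX]
    · rw [← ENNReal.coe_mul, ← ENNReal.coe_add, ENNReal.coe_lt_coe, ← NNReal.coe_lt_coe]
      push_cast [NNReal.coe_sub hβ]
      have h1 : (s : ℝ) ≤ t := by exact_mod_cast hst.le
      have h2 : (c : ℝ) < R := by exact_mod_cast hr
      have h3 : (α : ℝ) * s ≤ α * t := by gcongr
      linarith

open TopologicalSpace (denseSeq denseRange_denseSeq) in
/-- Countably many affine minorants suffice: their slopes and intercepts may be taken from a
countable dense set, since lowering the slope and raising `β` keeps a minorant a minorant. -/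
theorem exists_isAffineMinorant_denseSeq (hφ : IsConvexPhi φ) {t : ℝ≥0} {c : ℝ≥0∞}
    (hc : c < φ t) :
    ∃ m n : ℕ, IsAffineMinorant φ (denseSeq ℝ≥0 m) (denseSeq ℝ≥0 n) ∧
      c + denseSeq ℝ≥0 n < denseSeq ℝ≥0 m * t := by
  obtain ⟨α, β, hm, h⟩ := hφ.exists_isAffineMinorant hc
  lift c to ℝ≥0 using hc.ne_top
  rw [← ENNReal.coe_mul, ← ENNReal.coe_add, ENNReal.coe_lt_coe] at h
  have ht : 0 < t := by
    rcases eq_zero_or_pos t with rfl | h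
    · simp at h
    · exact h
  have hα : (c + β) / t < α := by rwa [div_lt_iff₀ ht]
  obtain ⟨_, ⟨m, rfl⟩, h1, h2⟩ := (denseRange_denseSeq ℝ≥0).exists_between hα
  rw [div_lt_iff₀ ht] at h1
  have hβ : β < denseSeq ℝ≥0 m * t - c := by
    rwa [lt_tsub_iff_left]
  obtain ⟨_, ⟨n, rfl⟩, h3, h4⟩ := (denseRange_denseSeq ℝ≥0).exists_between hβ
  refine ⟨m, n, fun x => ?_, ?_⟩
  · calc (denseSeq ℝ≥0 m : ℝ≥0∞) * x ≤ α * x := by gcongr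
      _ ≤ φ x + β := hm x
      _ ≤ _ := by gcongr
  · rw [lt_tsub_iff_left] at h4
    exact_mod_cast h4

/-- The asymptotic slope of `φ` at infinity, `lim_{t → ∞} φ t / t`, written as a supremum. -/
theorem tendsto_div_atTop (hφ : IsConvexPhi φ) :
    Tendsto (fun t : ℝ≥0 => φ t / t) atTop (𝓝 (⨆ t : ℝ≥0, φ t / t)) := by
  refine tendsto_atTop_iSup fun s t hst => ?_
  rcases eq_zero_or_pos s with rfl | hs
  · simp [hφ.map_zero]
  rcases hst.eq_or_lt with rfl | hst
  · exact le_rfl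
  have h := hφ.mul_apply_le hs hst
  simp only [tsub_zero, hφ.map_zero, mul_zero, zero_add] at h
  have hs' : (s : ℝ≥0∞) ≠ 0 := by exact_mod_cast hs.ne'
  have ht' : (t : ℝ≥0∞) ≠ 0 := by exact_mod_cast (hs.trans hst).ne'
  rw [ENNReal.div_le_iff hs' ENNReal.coe_ne_top, ← ENNReal.mul_div_right_comm,
    ENNReal.le_div_iff_mul_le (Or.inl ht') (Or.inl ENNReal.coe_ne_top)]
  calc φ s * t = t * φ s := mul_comm _ _
    _ ≤ s * φ t := h
    _ = φ t * s := mul_comm _ _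

theorem exists_isAffineMinorant_of_lt_iSup (hφ : IsConvexPhi φ) {c : ℝ≥0∞}
    (hc : c < ⨆ t : ℝ≥0, φ t / t) :
    ∃ α β : ℝ≥0, IsAffineMinorant φ α β ∧ c < α := by
  obtain ⟨t, ht⟩ := lt_iSup_iff.1 hc
  have ht0 : t ≠ 0 := by
    rintro rfl
    simp [hφ.map_zero] at ht
  rw [ENNReal.lt_div_iff_mul_lt (by simp [ht0]) (by simp)] at ht
  obtain ⟨α, β, hm, h⟩ := hφ.exists_isAffineMinorant ht
  exact ⟨α, β, hm, lt_of_mul_lt_mul_right' (le_self_add.trans_lt h)⟩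

theorem exists_isAffineMinorant_pos (hφ : IsConvexPhi φ) :
    ∃ α β : ℝ≥0, IsAffineMinorant φ α β ∧ 0 < α := by
  obtain ⟨t, ht⟩ := (hφ.tendsto_atTop.eventually (lt_mem_nhds ENNReal.zero_lt_top)).exists
  obtain ⟨α, β, hm, h⟩ := hφ.exists_isAffineMinorant ht
  refine ⟨α, β, hm, pos_iff_ne_zero.2 ?_⟩
  rintro rfl
  simp at h

end IsConvexPhi

theorem IsAffineMinorant.slope_le_iSup {φ : ℝ≥0 → ℝ≥0∞} {α β : ℝ≥0}
    (h : IsAffineMinorant φ α β) : (α : ℝ≥0∞) ≤ ⨆ t : ℝ≥0, φ t / t := by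
  by_contra! hK
  obtain ⟨K, hK'⟩ : ∃ K : ℝ≥0, (K : ℝ≥0∞) = ⨆ t : ℝ≥0, φ t / t :=
    ⟨_, ENNReal.coe_toNNReal hK.ne_top⟩
  have hle : ∀ t : ℝ≥0, t ≠ 0 → (α : ℝ≥0∞) * t ≤ K * t + β := fun t ht => by
    refine (h t).trans ?_
    gcongr
    rw [hK', ← ENNReal.div_le_iff (by exact_mod_cast ht) ENNReal.coe_ne_top]
    exact le_iSup (fun t : ℝ≥0 => φ t / t) t
  rw [← hK', ENNReal.coe_lt_coe] at hK
  have hpos := tsub_pos_of_lt hK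
  have h1 := hle ((β + 1) / (α - K)) (by positivity)
  norm_cast at h1
  have h2 : α * ((β + 1) / (α - K)) = K * ((β + 1) / (α - K)) + (β + 1) := by
    conv_lhs => rw [← add_tsub_cancel_of_le hK.le, add_mul]
    rw [add_tsub_cancel_of_le hK.le, mul_div_cancel₀ _ hpos.ne']
  rw [h2, ← add_assoc] at h1
  exact absurd h1 (not_le.2 (lt_add_one _))

/-! ### Partitions and the growth of the variation -/

theorem exists_isPartition {a b : ℝ} (hab : a ≤ b) : ∃ n u, IsPartition a b n u := by
  rcases hab.eq_or_lt with rfl | h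
  · exact ⟨0, fun _ => a, rfl, rfl, by simp⟩
  · refine ⟨1, fun i => if i = 0 then a else b, by simp, by simp, ?_⟩
    intro i hi
    obtain rfl : i = 0 := by lia
    simpa using h

theorem IsPartition.mem_Icc {a b : ℝ} {n : ℕ} {u : ℕ → ℝ} (hu : IsPartition a b n u) {i : ℕ}
    (hi : i ≤ n) : u i ∈ Icc a b := by
  have hmono : MonotoneOn u (Icc 0 n) :=
    monotoneOn_of_le_succ ordConnected_Icc fun i _ _ hi => (hu.2.2 i (by simpa using hi.2)).le
  exact ⟨hu.1 ▸ hmono (by simp) (by simpa using hi) (Nat.zero_le i),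
    hu.2.1 ▸ hmono (by simpa using hi) (by simp) hi⟩

theorem rieszSum_le_rieszVariation (φ : ℝ≥0 → ℝ≥0∞) {a b : ℝ} (f : ℝ → ℝ) {n : ℕ} {u : ℕ → ℝ}
    (hu : IsPartition a b n u) : rieszSum φ f n u ≤ rieszVariation φ a b f :=
  le_iSup_of_le n <| le_iSup_of_le u <| le_iSup_of_le hu le_rfl

theorem rieszVariation_le (φ : ℝ≥0 → ℝ≥0∞) {a b : ℝ} (f : ℝ → ℝ) {C : ℝ≥0∞}
    (h : ∀ n u, IsPartition a b n u → rieszSum φ f n u ≤ C) : rieszVariation φ a b f ≤ C :=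
  iSup_le fun n => iSup_le fun u => iSup_le fun hu => h n u hu

/-- Appending the interval `[x, y]` to a partition of `[a, x]`. -/
theorem rieszVariation_add_le (φ : ℝ≥0 → ℝ≥0∞) (f : ℝ → ℝ) {a x y : ℝ} (hax : a ≤ x)
    (hxy : x < y) :
    rieszVariation φ a x f + φ ‖(f y - f x) / (y - x)‖₊ * ENNReal.ofReal (y - x) ≤
      rieszVariation φ a y f := by
  have key : ∀ n u, IsPartition a x n u →
      rieszSum φ f n u + φ ‖(f y - f x) / (y - x)‖₊ * ENNReal.ofReal (y - x) ≤
        rieszVariation φ a y f := by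
    intro n u hu
    have hv : IsPartition a y (n + 1) (fun i => if i ≤ n then u i else y) := by
      refine ⟨by simpa using hu.1, by simp, fun i hi => ?_⟩
      rcases (Nat.lt_succ_iff.1 hi).eq_or_lt with rfl | h
      · simpa [hu.2.1] using hxy
      · have : i + 1 ≤ n := h
        simpa [h.le, this] using hu.2.2 i h
    refine le_of_eq_of_le ?_ (rieszSum_le_rieszVariation φ f hv)
    rw [rieszSum, rieszSum, Finset.sum_range_succ]
    congr 1
    · refine Finset.sum_congr rfl fun i hi => ?_
      have hi : i < n := Finset.mem_range.1 hi
      have hi' : i + 1 ≤ n := hi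
      simp [hi.le, hi']
    · simp [hu.2.1]
  obtain ⟨n, u, hu⟩ := exists_isPartition hax
  by_cases htop : φ ‖(f y - f x) / (y - x)‖₊ * ENNReal.ofReal (y - x) = ∞
  · have := le_add_self.trans (key n u hu)
    rw [htop, top_le_iff] at this
    simp [this]
  · refine add_le_of_le_tsub_right_of_le (le_add_self.trans (key n u hu)) ?_
    exact rieszVariation_le φ f fun n u hu => ENNReal.le_sub_of_add_le_right htop (key n u hu)

theorem rieszVariation_mono (φ : ℝ≥0 → ℝ≥0∞) (f : ℝ → ℝ) {a x y : ℝ} (hax : a ≤ x)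
    (hxy : x ≤ y) : rieszVariation φ a x f ≤ rieszVariation φ a y f := by
  rcases hxy.eq_or_lt with rfl | h
  · exact le_rfl
  · exact le_self_add.trans (rieszVariation_add_le φ f hax h)

theorem nnnorm_div_mul_ofReal (d : ℝ) {l : ℝ} (hl : 0 < l) :
    ((‖d / l‖₊ : ℝ≥0) : ℝ≥0∞) * ENNReal.ofReal l = ‖d‖ₑ := by
  rw [← enorm_eq_nnnorm, ← Real.enorm_of_nonneg hl.le, ← enorm_mul, div_mul_cancel₀ _ hl.ne']

/-- An affine minorant `t ↦ α t - β` of `φ` bounds the increments of `f` by those of the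
function `x ↦ V_[a, x](f)`. -/
theorem IsAffineMinorant.mul_abs_sub_le {φ : ℝ≥0 → ℝ≥0∞} {α β : ℝ≥0}
    (hm : IsAffineMinorant φ α β) {f : ℝ → ℝ} {a b x y : ℝ} (hV : rieszVariation φ a b f < ∞)
    (hax : a ≤ x) (hxy : x ≤ y) (hyb : y ≤ b) :
    α * |f y - f x| ≤ (rieszVariation φ a y f).toReal - (rieszVariation φ a x f).toReal +
      β * (y - x) := by
  rcases hxy.eq_or_lt with rfl | hlt
  · simp
  have hl : 0 < y - x := sub_pos.2 hlt
  have hy : rieszVariation φ a y f ≠ ∞ :=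
    ((rieszVariation_mono φ f (hax.trans hxy) hyb).trans_lt hV).ne
  have hx : rieszVariation φ a x f ≠ ∞ :=
    ne_top_of_le_ne_top hy (rieszVariation_mono φ f hax hxy)
  have h : rieszVariation φ a x f + α * ‖f y - f x‖ₑ ≤
      rieszVariation φ a y f + β * ENNReal.ofReal (y - x) := by
    calc rieszVariation φ a x f + α * ‖f y - f x‖ₑ
        = rieszVariation φ a x f +
            α * (‖(f y - f x) / (y - x)‖₊ : ℝ≥0) * ENNReal.ofReal (y - x) := by
          rw [mul_assoc, nnnorm_div_mul_ofReal _ hl]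
      _ ≤ rieszVariation φ a x f +
            (φ ‖(f y - f x) / (y - x)‖₊ + β) * ENNReal.ofReal (y - x) := by
          gcongr
          exact hm _
      _ ≤ _ := by
          rw [add_mul, ← add_assoc]
          gcongr
          exact rieszVariation_add_le φ f hax hlt
  have h' := ENNReal.toReal_mono
    (ENNReal.add_ne_top.2 ⟨hy, ENNReal.mul_ne_top ENNReal.coe_ne_top ENNReal.ofReal_ne_top⟩) h
  rw [ENNReal.toReal_add hx (ENNReal.mul_ne_top ENNReal.coe_ne_top enorm_ne_top),
    ENNReal.toReal_add hy (ENNReal.mul_ne_top ENNReal.coe_ne_top ENNReal.ofReal_ne_top),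
    ENNReal.toReal_mul, ENNReal.toReal_mul, ENNReal.toReal_ofReal hl.le, toReal_enorm,
    Real.norm_eq_abs] at h'
  simp only [ENNReal.coe_toReal] at h'
  linarith

theorem rieszVariation_toReal_monotoneOn {φ : ℝ≥0 → ℝ≥0∞} {f : ℝ → ℝ} {a b : ℝ}
    (hV : rieszVariation φ a b f < ∞) :
    MonotoneOn (fun x => (rieszVariation φ a x f).toReal) (Icc a b) := fun _ hx _ hy hxy =>
  ENNReal.toReal_mono
    (ne_top_of_le_ne_top hV.ne (rieszVariation_mono φ f (hx.1.trans hxy) hy.2))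
    (rieszVariation_mono φ f hx.1 hxy)

/-- Functions of finite Riesz `φ`-variation have bounded variation: if `t ↦ α t - β` is an affine
minorant of `φ` with `0 < α`, then the increments of `f` are dominated by those of the monotone
function `x ↦ α⁻¹ (V_[a, x](f) + β x)`. -/
theorem IsConvexPhi.boundedVariationOn {φ : ℝ≥0 → ℝ≥0∞} (hφ : IsConvexPhi φ) {f : ℝ → ℝ}
    {a b : ℝ} (hV : rieszVariation φ a b f < ∞) : BoundedVariationOn f (Icc a b) := by
  obtain ⟨α, β, hm, hα⟩ := hφ.exists_isAffineMinorant_pos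
  have hα' : (0 : ℝ) < α := by exact_mod_cast hα
  rcases lt_or_ge b a with hab | hab
  · rw [Icc_eq_empty (not_le.2 hab)]
    exact BoundedVariationOn.of_subsingleton subsingleton_empty
  have hβ : (0 : ℝ) ≤ β := β.2
  set H : ℝ → ℝ := fun x =>
    (α : ℝ)⁻¹ * ((rieszVariation φ a x f).toReal + β * x) with hH
  have hHm : MonotoneOn H (Icc a b) := fun x hx y hy hxy => by
    have := rieszVariation_toReal_monotoneOn hV hx hy hxy
    simp only [hH]
    gcongr
  have hHv := hHm.eVariationOn_eq (left_mem_Icc.2 hab) (right_mem_Icc.2 hab)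
  rw [inter_self] at hHv
  refine ne_top_of_le_ne_top (b := eVariationOn H (Icc a b)) (by simp [hHv]) ?_
  refine iSup_le fun p => ?_
  refine le_trans ?_ (eVariationOn.sum_le (f := H) (n := p.1) p.2.2.1 p.2.2.2)
  refine Finset.sum_le_sum fun i _ => ?_
  have h1 := p.2.2.2 i
  have h2 := p.2.2.2 (i + 1)
  have h3 := p.2.2.1 (Nat.le_succ i)
  have h4 := hm.mul_abs_sub_le hV h1.1 h3 h2.2
  rw [edist_dist, edist_dist]
  refine ENNReal.ofReal_le_ofReal ?_
  rw [Real.dist_eq, Real.dist_eq, abs_of_nonneg (sub_nonneg.2 (hHm h1 h2 h3))]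
  simp only [hH, ← mul_sub]
  rw [← div_eq_inv_mul, le_div_iff₀ hα']
  linarith

/-! ### The measure inequalities behind the lower bound -/

/-- If each of two mutually singular measures is dominated by `ρ` plus the other one, then their
sum is dominated by `ρ`. -/
theorem MeasureTheory.Measure.MutuallySingular.add_le {X : Type*} [MeasurableSpace X]
    {μ ν ρ : Measure X} (h : μ ⟂ₘ ν) (hμ : μ ≤ ρ + ν) (hν : ν ≤ ρ + μ) : μ + ν ≤ ρ := by
  obtain ⟨s, hs, h1, h2⟩ := h
  refine Measure.le_iff.2 fun A hA => ?_
  have h3 : μ (A ∩ s) = 0 := measure_mono_null inter_subset_right h1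
  have h4 : ν (A \ s) = 0 := measure_mono_null (fun x hx => hx.2) h2
  have h5 := hμ (A \ s)
  have h6 := hν (A ∩ s)
  rw [Measure.add_apply, h4, add_zero] at h5
  rw [Measure.add_apply, h3, add_zero] at h6
  rw [Measure.add_apply, ← measure_inter_add_sdiff A hs, ← measure_inter_add_sdiff (μ := ν) A hs,
    ← measure_inter_add_sdiff (μ := ρ) A hs, h3, h4, zero_add, add_zero, add_comm]
  exact add_le_add h6 h5

/-- A pointwise inequality between increments passes to the associated measures: the function
`x ↦ G x + β x - α g x` is monotone, and adding its Stieltjes measure to `α • P` gives the right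
hand side. -/
theorem smul_le_stieltjes_add {g G r : ℝ → ℝ} (hG : Monotone G) {α β : ℝ≥0}
    (h : ∀ x y, x ≤ y → α * (g y - g x) ≤ G y - G x + β * (y - x))
    (hr : ∀ x, Tendsto g (𝓝[>] x) (𝓝 (r x))) {P M : Measure ℝ} [IsFiniteMeasure P]
    [IsFiniteMeasure M] (hPM : ∀ x y, x ≤ y → P.real (Ioc x y) - M.real (Ioc x y) = r y - r x) :
    α • P ≤ (hG.stieltjesFunction.measure + β • volume) + α • M := by
  have hH : Monotone fun x => G x + β * x - α * g x := fun x y hxy => by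
    have := h x y hxy
    dsimp only
    linarith
  have hlim : ∀ x, hH.stieltjesFunction x = hG.stieltjesFunction x + β * x - α * r x := by
    intro x
    refine tendsto_nhds_unique (hH.tendsto_rightLim x) ?_
    refine ((hG.tendsto_rightLim x).add ?_).sub ((hr x).const_mul _)
    exact ((continuous_const.mul continuous_id).tendsto x).mono_left nhdsWithin_le_nhds
  have key : hH.stieltjesFunction.measure + α • P =
      (hG.stieltjesFunction.measure + β • volume) + α • M := by
    refine Measure.ext_of_Ioc' _ _ (fun x y _ => ?_) fun x y hxy => ?_
    · rw [Measure.add_apply, StieltjesFunction.measure_Ioc]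
      exact ENNReal.add_ne_top.2 ⟨ENNReal.ofReal_ne_top, measure_ne_top _ _⟩
    have hd := hH.stieltjesFunction.mono hxy.le
    have hd' := hG.stieltjesFunction.mono hxy.le
    have hP : P (Ioc x y) = ENNReal.ofReal (P.real (Ioc x y)) := by simp
    have hM : M (Ioc x y) = ENNReal.ofReal (M.real (Ioc x y)) := by simp
    have hP0 : 0 ≤ P.real (Ioc x y) := measureReal_nonneg
    have hM0 : 0 ≤ M.real (Ioc x y) := measureReal_nonneg
    have hα : (0 : ℝ) ≤ α := α.2
    have hβ : (0 : ℝ) ≤ β := β.2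
    have hxy' : 0 ≤ y - x := by linarith
    simp only [Measure.add_apply, Measure.smul_apply, StieltjesFunction.measure_Ioc,
      Real.volume_Ioc, hP, hM, ENNReal.smul_def, smul_eq_mul, ← ENNReal.ofReal_coe_nnreal]
    rw [← ENNReal.ofReal_mul hα, ← ENNReal.ofReal_mul hα, ← ENNReal.ofReal_mul hβ,
      ← ENNReal.ofReal_add (by linarith) (by positivity),
      ← ENNReal.ofReal_add (by linarith) (by positivity),
      ← ENNReal.ofReal_add (by have := mul_nonneg hβ hxy'; linarith) (by positivity)]
    congr 1
    rw [hlim, hlim]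
    linear_combination α * hPM x y hxy.le
  rw [← key]
  exact Measure.le_add_left le_rfl

/-- If `α |g y - g x| ≤ G y - G x + β (y - x)` for all `x ≤ y`, then `α |Dg| ≤ dG + β dx`. -/
theorem BoundedVariationOn.smul_totalVariation_vectorMeasure_le {g G : ℝ → ℝ}
    (hg : BoundedVariationOn g univ) (hG : Monotone G) {α β : ℝ≥0}
    (h : ∀ x y, x ≤ y → α * |g y - g x| ≤ G y - G x + β * (y - x)) :
    α • SignedMeasure.totalVariation hg.vectorMeasure ≤
      hG.stieltjesFunction.measure + β • volume := by
  set j := SignedMeasure.toJordanDecomposition hg.vectorMeasure with hj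
  have hα : (0 : ℝ) ≤ α := α.2
  have hd : ∀ x y, x ≤ y →
      j.posPart.real (Ioc x y) - j.negPart.real (Ioc x y) = g.rightLim y - g.rightLim x := by
    intro x y hxy
    rw [← hg.vectorMeasure_Ioc hxy]
    conv_rhs =>
      rw [← SignedMeasure.toSignedMeasure_toJordanDecomposition hg.vectorMeasure,
        JordanDecomposition.toSignedMeasure, Measure.toSignedMeasure_sub_apply measurableSet_Ioc]
  rw [SignedMeasure.totalVariation, smul_add]
  refine Measure.MutuallySingular.add_le (j.mutuallySingular.smul α |>.symm.smul α |>.symm) ?_ ?_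
  · exact smul_le_stieltjes_add hG
      (fun x y hxy => (mul_le_mul_of_nonneg_left (le_abs_self _) hα).trans (h x y hxy))
      hg.tendsto_rightLim hd
  · refine smul_le_stieltjes_add (g := fun x => -g x) (r := fun x => -g.rightLim x) hG
      (fun x y hxy => ?_) (fun x => (hg.tendsto_rightLim x).neg) fun x y hxy => ?_
    · refine (mul_le_mul_of_nonneg_left ?_ hα).trans (h x y hxy)
      rw [neg_sub_neg, abs_sub_comm]
      exact le_abs_self _
    · linarith [hd x y hxy]

theorem MeasureTheory.SignedMeasure.enorm_rnDeriv_le {X : Type*} [MeasurableSpace X]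
    (s : SignedMeasure X) (μ : Measure X) [SigmaFinite μ] :
    ∀ᵐ x ∂μ, ‖s.rnDeriv μ x‖ₑ ≤ s.totalVariation.rnDeriv μ x := by
  filter_upwards [Measure.rnDeriv_add' s.toJordanDecomposition.posPart
    s.toJordanDecomposition.negPart μ] with x hx
  rw [SignedMeasure.totalVariation, hx, SignedMeasure.rnDeriv_def]
  refine (enorm_sub_le).trans (add_le_add ?_ ?_) <;>
  · rw [Real.enorm_of_nonneg ENNReal.toReal_nonneg]
    exact ENNReal.ofReal_toReal_le

theorem MeasureTheory.SignedMeasure.enorm_apply_le_totalVariation {X : Type*} [MeasurableSpace X]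
    (s : SignedMeasure X) {A : Set X} (hA : MeasurableSet A) : ‖s A‖ₑ ≤ s.totalVariation A := by
  conv_lhs =>
    rw [← SignedMeasure.toSignedMeasure_toJordanDecomposition s,
      JordanDecomposition.toSignedMeasure, Measure.toSignedMeasure_sub_apply hA]
  rw [SignedMeasure.totalVariation, Measure.add_apply]
  refine (enorm_sub_le).trans (add_le_add ?_ ?_) <;>
  · rw [Real.enorm_of_nonneg measureReal_nonneg]
    exact ENNReal.ofReal_toReal_le

open TopologicalSpace (denseSeq) in
/-- The lower bound, for a measure `ν` that dominates `α |s| - β dx` for every affine minorant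
`t ↦ α t - β` of `φ`. The absolutely continuous part of `ν` dominates the countable supremum of
the `α |f'| - β`; on a null set carrying the singular part of `s` the term `β dx` disappears. -/
theorem IsConvexPhi.lintegral_add_le {φ : ℝ≥0 → ℝ≥0∞} (hφ : IsConvexPhi φ)
    (s : SignedMeasure ℝ) (ν : Measure ℝ) [IsFiniteMeasure ν]
    (h : ∀ α β, IsAffineMinorant φ α β → α • s.totalVariation ≤ ν + β • volume) :
    (∫⁻ x, φ ‖s.rnDeriv volume x‖₊) +
      (⨆ t : ℝ≥0, φ t / t) * (s.singularPart volume).totalVariation univ ≤ ν univ := by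
  have hac : ∀ᵐ x, φ ‖s.rnDeriv volume x‖₊ ≤ ν.rnDeriv volume x := by
    have hmn : ∀ m n : ℕ, IsAffineMinorant φ (denseSeq ℝ≥0 m) (denseSeq ℝ≥0 n) → ∀ᵐ x,
        denseSeq ℝ≥0 m * ‖s.rnDeriv volume x‖ₑ ≤ ν.rnDeriv volume x + denseSeq ℝ≥0 n := by
      intro m n hm
      have hle := h _ _ hm
      set α := denseSeq ℝ≥0 m
      set β := denseSeq ℝ≥0 n
      have : SigmaFinite (ν + β • (volume : Measure ℝ) - α • s.totalVariation) :=
        Measure.sigmaFinite_of_le _ Measure.sub_le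
      have hadd := Measure.rnDeriv_add' (ν + β • volume - α • s.totalVariation)
        (α • s.totalVariation) volume
      rw [Measure.sub_add_cancel_of_le hle] at hadd
      filter_upwards [hadd, Measure.rnDeriv_add' ν (β • volume) volume,
        Measure.rnDeriv_smul_left' volume volume β, Measure.rnDeriv_self (volume : Measure ℝ),
        Measure.rnDeriv_smul_left' s.totalVariation volume α, s.enorm_rnDeriv_le volume]
        with x h1 h2 h3 h4 h5 h6
      simp only [Pi.add_apply, Pi.smul_apply, ENNReal.smul_def, smul_eq_mul] at h1 h2 h3 h5
      rw [h4, mul_one] at h3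
      rw [← h3, ← h2, h1, h5]
      exact le_add_left (by gcongr)
    have hall : ∀ᵐ x, ∀ m n : ℕ, IsAffineMinorant φ (denseSeq ℝ≥0 m) (denseSeq ℝ≥0 n) →
        denseSeq ℝ≥0 m * ‖s.rnDeriv volume x‖ₑ ≤ ν.rnDeriv volume x + denseSeq ℝ≥0 n := by
      simp only [ae_all_iff]
      exact hmn
    filter_upwards [hall] with x hx
    refine le_of_forall_lt fun c hc => ?_
    obtain ⟨m, n, hm, hlt⟩ := hφ.exists_isAffineMinorant_denseSeq hc
    have := hlt.trans_le (hx m n hm)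
    exact lt_of_add_lt_add_right this
  obtain ⟨N, hN, hsN, hvN⟩ : (s.singularPart volume).totalVariation ⟂ₘ (volume : Measure ℝ) := by
    rw [SignedMeasure.singularPart_totalVariation]
    exact (Measure.mutuallySingular_singularPart _ _).add_left
      (Measure.mutuallySingular_singularPart _ _)
  have hsing : (⨆ t : ℝ≥0, φ t / t) * (s.singularPart volume).totalVariation univ ≤ ν Nᶜ := by
    have hs : (s.singularPart volume).totalVariation univ ≤ s.totalVariation Nᶜ := by
      rw [← measure_add_measure_compl hN, hsN, zero_add, SignedMeasure.singularPart_totalVariation]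
      exact add_le_add (Measure.singularPart_le _ _ _) (Measure.singularPart_le _ _ _)
    refine ENNReal.mul_le_of_forall_lt fun c hc d hd => ?_
    obtain ⟨α, β, hm, hcα⟩ := hφ.exists_isAffineMinorant_of_lt_iSup hc
    calc c * d ≤ α * s.totalVariation Nᶜ := mul_le_mul' hcα.le (hd.le.trans hs)
      _ ≤ (ν + β • volume : Measure ℝ) Nᶜ := h α β hm Nᶜ
      _ = ν Nᶜ := by simp [hvN]
  calc _ ≤ ν N + ν Nᶜ := by
        refine add_le_add ?_ hsing
        calc ∫⁻ x, φ ‖s.rnDeriv volume x‖₊ = ∫⁻ x in N, φ ‖s.rnDeriv volume x‖₊ := by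
              rw [← lintegral_add_compl _ hN, setLIntegral_measure_zero _ _ hvN, add_zero]
          _ ≤ ∫⁻ x in N, ν.rnDeriv volume x := lintegral_mono_ae (ae_restrict_of_ae hac)
          _ ≤ ν N := Measure.setLIntegral_rnDeriv_le _
    _ = ν univ := measure_add_measure_compl hN

/-! ### The representation formula -/

theorem clamp_sub_clamp_le {a b x y : ℝ} (hxy : x ≤ y) :
    max a (min y b) - max a (min x b) ≤ y - x := by
  grind

theorem clampExtend_monotone {G : ℝ → ℝ} {a b : ℝ} (hab : a ≤ b) (hG : MonotoneOn G (Icc a b)) :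
    Monotone (clampExtend G a b) := fun _ _ hxy =>
  hG ⟨le_max_left _ _, max_le hab (min_le_right _ _)⟩
    ⟨le_max_left _ _, max_le hab (min_le_right _ _)⟩ (max_le_max le_rfl (min_le_min hxy le_rfl))

theorem clampExtend_of_le {f : ℝ → ℝ} {a b x : ℝ} (hx : x ≤ a) : clampExtend f a b x = f a := by
  rw [clampExtend, max_eq_left ((min_le_left _ _).trans hx)]

theorem clampExtend_of_ge {f : ℝ → ℝ} {a b x : ℝ} (hab : a ≤ b) (hx : b ≤ x) :
    clampExtend f a b x = f b := by
  rw [clampExtend, min_eq_right hx, max_eq_right hab]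

/-- The total mass of the Stieltjes measure of a monotone function on `[a, b]`, extended by
constants. -/
theorem stieltjesFunction_clampExtend_measure_univ {G : ℝ → ℝ} {a b : ℝ} (hab : a ≤ b)
    (hG : MonotoneOn G (Icc a b)) :
    (clampExtend_monotone hab hG).stieltjesFunction.measure univ = ENNReal.ofReal (G b - G a) := by
  refine StieltjesFunction.measure_univ _ ?_ ?_
  · refine tendsto_const_nhds.congr' ?_
    filter_upwards [eventually_lt_atBot a] with x hx
    refine tendsto_nhds_unique (tendsto_const_nhds.congr' ?_)
      ((clampExtend_monotone hab hG).tendsto_rightLim x)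
    filter_upwards [nhdsWithin_le_nhds (eventually_lt_nhds hx)] with y hy
    exact (clampExtend_of_le hy.le).symm
  · refine tendsto_const_nhds.congr' ?_
    filter_upwards [eventually_gt_atTop b] with x hx
    refine tendsto_nhds_unique (tendsto_const_nhds.congr' ?_)
      ((clampExtend_monotone hab hG).tendsto_rightLim x)
    filter_upwards [nhdsWithin_le_nhds (eventually_gt_nhds hx)] with y hy
    exact (clampExtend_of_ge hab hy.le).symm

namespace IsConvexPhi

variable {φ : ℝ≥0 → ℝ≥0∞} {f : ℝ → ℝ} {a b : ℝ}

theorem orliczModular_add_le_rieszVariation (hφ : IsConvexPhi φ) (hab : a ≤ b)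
    (hf : BoundedVariationOn f (Icc a b)) (hV : rieszVariation φ a b f < ∞) :
    orliczModular φ a b (acDensity hab hf) +
      (⨆ t : ℝ≥0, φ t / t) * singularVariation hab hf (Icc a b) ≤ rieszVariation φ a b f := by
  have hG := rieszVariation_toReal_monotoneOn hV
  have huniv := stieltjesFunction_clampExtend_measure_univ hab hG
  have hfin : IsFiniteMeasure (clampExtend_monotone hab hG).stieltjesFunction.measure :=
    ⟨by rw [huniv]; exact ENNReal.ofReal_lt_top⟩
  have key := hφ.lintegral_add_le (derivMeasure hab hf) _ fun α β hm =>
    (clampExtend_boundedVariationOn hab hf).smul_totalVariation_vectorMeasure_le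
      (clampExtend_monotone hab hG) (α := α) (β := β) fun x y hxy => by
        have hc : max a (min x b) ≤ max a (min y b) := max_le_max le_rfl (min_le_min hxy le_rfl)
        refine (hm.mul_abs_sub_le hV (le_max_left _ _) hc
          (max_le hab (min_le_right _ _))).trans ?_
        simp only [clampExtend]
        exact add_le_add le_rfl (mul_le_mul_of_nonneg_left (clamp_sub_clamp_le hxy) β.2)
  calc _ ≤ _ := add_le_add (setLIntegral_le_lintegral _ _)
        (mul_le_mul_right (measure_mono (subset_univ _)) _)
    _ ≤ _ := key
    _ ≤ _ := by
        rw [huniv]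
        refine (ENNReal.ofReal_le_ofReal (sub_le_self _ ENNReal.toReal_nonneg)).trans ?_
        exact ENNReal.ofReal_toReal_le

/-- Jensen's inequality on one interval, including the singular part: integrate the affine
minorants of `φ`, whose slopes are at most `lim φ t / t`. -/
theorem apply_mul_ofReal_le (hφ : IsConvexPhi φ) (hab : a ≤ b)
    (hf : BoundedVariationOn f (Icc a b)) (hl : IsLeftContinuousOn f a b) {x y : ℝ}
    (hx : x ∈ Icc a b) (hy : y ∈ Icc a b) (hxy : x < y) :
    φ ‖(f y - f x) / (y - x)‖₊ * ENNReal.ofReal (y - x) ≤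
      (∫⁻ t in Ico x y, φ ‖acDensity hab hf t‖₊) +
        (⨆ t : ℝ≥0, φ t / t) * singularVariation hab hf (Ico x y) := by
  have hpos : 0 < y - x := sub_pos.2 hxy
  have hD : ‖f y - f x‖ₑ ≤ (∫⁻ t in Ico x y, ‖acDensity hab hf t‖ₑ) +
      singularVariation hab hf (Ico x y) := by
    rw [← derivMeasure_Ico hab hf hl hx hy hxy.le,
      ← (derivMeasure hab hf).singularPart_add_withDensity_rnDeriv_eq volume,
      _root_.add_apply,
      withDensityᵥ_apply ((derivMeasure hab hf).integrable_rnDeriv volume) measurableSet_Ico,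
      add_comm]
    exact (enorm_add_le _ _).trans (add_le_add (enorm_integral_le_lintegral_enorm _)
      (SignedMeasure.enorm_apply_le_totalVariation _ measurableSet_Ico))
  rw [← ENNReal.le_div_iff_mul_le (Or.inl (by simpa using hpos)) (Or.inl ENNReal.ofReal_ne_top)]
  refine le_of_forall_lt fun c hc => ?_
  obtain ⟨α, β, hm, hlt⟩ := hφ.exists_isAffineMinorant hc
  have hL0 : ENNReal.ofReal (y - x) ≠ 0 := by simpa using hpos
  rw [ENNReal.lt_div_iff_mul_lt (Or.inl hL0) (Or.inl ENNReal.ofReal_ne_top)]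
  have h1 : c * ENNReal.ofReal (y - x) + β * ENNReal.ofReal (y - x) < α * ‖f y - f x‖ₑ := by
    rw [← add_mul, ← nnnorm_div_mul_ofReal _ hpos, ← mul_assoc]
    exact (ENNReal.mul_lt_mul_iff_left hL0 ENNReal.ofReal_ne_top).2 hlt
  have h2 : α * ‖f y - f x‖ₑ ≤ ((∫⁻ t in Ico x y, φ ‖acDensity hab hf t‖₊) +
      (⨆ t : ℝ≥0, φ t / t) * singularVariation hab hf (Ico x y)) +
        β * ENNReal.ofReal (y - x) := by
    calc α * ‖f y - f x‖ₑ
        ≤ (∫⁻ t in Ico x y, α * ‖acDensity hab hf t‖ₑ) +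
            α * singularVariation hab hf (Ico x y) := by
          rw [lintegral_const_mul' _ _ ENNReal.coe_ne_top, ← mul_add]
          gcongr
      _ ≤ (∫⁻ t in Ico x y, (φ ‖acDensity hab hf t‖₊ + β)) +
            (⨆ t : ℝ≥0, φ t / t) * singularVariation hab hf (Ico x y) := by
          gcongr with t
          · exact hm _
          · exact hm.slope_le_iSup
      _ = _ := by
          rw [lintegral_add_right _ measurable_const, setLIntegral_const, Real.volume_Ico]
          ring
  exact lt_of_add_lt_add_right (h1.trans_le h2)

theorem rieszVariation_le_orliczModular_add (hφ : IsConvexPhi φ) (hab : a ≤ b)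
    (hf : BoundedVariationOn f (Icc a b)) (hl : IsLeftContinuousOn f a b) :
    rieszVariation φ a b f ≤ orliczModular φ a b (acDensity hab hf) +
      (⨆ t : ℝ≥0, φ t / t) * singularVariation hab hf (Icc a b) := by
  refine rieszVariation_le φ f fun n u hu => ?_
  set m : Measure ℝ := volume.withDensity (fun t => φ ‖acDensity hab hf t‖₊) +
    (⨆ t : ℝ≥0, φ t / t) • singularVariation hab hf with hm
  have hmA : ∀ A, MeasurableSet A → m A = (∫⁻ t in A, φ ‖acDensity hab hf t‖₊) +
      (⨆ t : ℝ≥0, φ t / t) * singularVariation hab hf A := fun A hA => by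
    simp [hm, withDensity_apply _ hA]
  have hsum : ∀ k ≤ n, rieszSum φ f k u ≤ m (Ico a (u k)) := by
    intro k
    induction k with
    | zero => simp [rieszSum]
    | succ k ih =>
      intro hk
      have hk' : k < n := hk
      have h1 := hu.mem_Icc hk'.le
      have h2 := hu.mem_Icc hk
      have h3 := hu.2.2 k hk'
      rw [rieszSum, Finset.sum_range_succ, ← Ico_union_Ico_eq_Ico h1.1 h3.le,
        measure_union (Ico_disjoint_Ico_same) measurableSet_Ico]
      refine add_le_add (ih hk'.le) ?_
      rw [hmA _ measurableSet_Ico]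
      exact hφ.apply_mul_ofReal_le hab hf hl h1 h2 h3
  have h := hsum n le_rfl
  rw [hu.2.1] at h
  refine (h.trans (measure_mono Ico_subset_Icc_self)).trans_eq ?_
  rw [hmA _ measurableSet_Icc, orliczModular]

theorem rieszVariation_eq (hφ : IsConvexPhi φ) (hab : a ≤ b)
    (hf : BoundedVariationOn f (Icc a b)) (hl : IsLeftContinuousOn f a b)
    (hV : rieszVariation φ a b f < ∞) :
    rieszVariation φ a b f = orliczModular φ a b (acDensity hab hf) +
      (⨆ t : ℝ≥0, φ t / t) * singularVariation hab hf (Icc a b) :=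
  (hφ.rieszVariation_le_orliczModular_add hab hf hl).antisymm
    (hφ.orliczModular_add_le_rieszVariation hab hf hV)

/-- If `φ` is superlinear, the affine minorants of large slope `α` give
`|f y - f x| ≤ (V + β |y - x|) / α`, a modulus of continuity. -/
theorem isLeftContinuousOn (hφ : IsConvexPhi φ) (hK : ⨆ t : ℝ≥0, φ t / t = ∞)
    (hV : rieszVariation φ a b f < ∞) : IsLeftContinuousOn f a b := by
  intro x hx
  rw [Metric.continuousWithinAt_iff]
  intro ε hε
  set V := (rieszVariation φ a b f).toReal with hVdef
  have hV0 : 0 ≤ V := ENNReal.toReal_nonneg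
  obtain ⟨α, β, hm, hα⟩ := hφ.exists_isAffineMinorant_of_lt_iSup
    (c := ENNReal.ofReal ((V + 1) / ε)) (by rw [hK]; exact ENNReal.ofReal_lt_top)
  have hα' : (V + 1) / ε < α := by
    rwa [← ENNReal.ofReal_coe_nnreal, ENNReal.ofReal_lt_ofReal_iff_of_nonneg (by positivity)] at hα
  rw [div_lt_iff₀ hε] at hα'
  have hβ : (0 : ℝ) ≤ β := β.2
  have hα0 : (0 : ℝ) < α := by
    rcases (α.2 : (0 : ℝ) ≤ α).eq_or_lt with h | h
    · have h' : (α : ℝ) = 0 := h.symm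
      rw [h', zero_mul] at hα'
      linarith
    · exact h
  refine ⟨1 / (β + 1), by positivity, fun y hy hyx => ?_⟩
  have h1 := hm.mul_abs_sub_le hV hy.1 hy.2 hx.2
  have h2 := rieszVariation_toReal_monotoneOn hV hx (right_mem_Icc.2 (hx.1.trans hx.2)) hx.2
  have h3 : 0 ≤ (rieszVariation φ a y f).toReal := ENNReal.toReal_nonneg
  rw [dist_comm, Real.dist_eq, abs_of_nonneg (sub_nonneg.2 hy.2), lt_div_iff₀ (by positivity)]
    at hyx
  rw [dist_comm, Real.dist_eq]
  dsimp only at h2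
  have h4 : 0 ≤ x - y := sub_nonneg.2 hy.2
  have h5 : (α : ℝ) * |f x - f y| < α * ε := by nlinarith
  exact lt_of_mul_lt_mul_left h5 hα0.le

/-- If `φ` is superlinear, the finite term `∞ * |Dˢf|` forces the singular part to vanish. -/
theorem singularVariation_eq_zero (hφ : IsConvexPhi φ) (hK : ⨆ t : ℝ≥0, φ t / t = ∞)
    (hab : a ≤ b) (hf : BoundedVariationOn f (Icc a b)) (hV : rieszVariation φ a b f < ∞) :
    singularVariation hab hf (Icc a b) = 0 := by
  have h := (le_add_self.trans (hφ.orliczModular_add_le_rieszVariation hab hf hV)).trans_lt hV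
  rw [hK] at h
  by_contra hne
  simp [ENNReal.top_mul hne] at h

end IsConvexPhi

/-! ### Vanishing singular part and absolute continuity -/

section AbsolutelyContinuous

variable {f : ℝ → ℝ} {a b : ℝ}

theorem integrable_acDensity (hab : a ≤ b) (hf : BoundedVariationOn f (Icc a b)) :
    Integrable (acDensity hab hf) volume :=
  (derivMeasure hab hf).integrable_rnDeriv volume

theorem eq_add_integral_acDensity (hab : a ≤ b) (hf : BoundedVariationOn f (Icc a b))
    (hl : IsLeftContinuousOn f a b) (hs : singularVariation hab hf (Icc a b) = 0) {x : ℝ}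
    (hx : x ∈ Icc a b) : f x = f a + ∫ t in a..x, acDensity hab hf t := by
  have h1 := derivMeasure_Ico hab hf hl (left_mem_Icc.2 hab) hx hx.1
  rw [← (derivMeasure hab hf).singularPart_add_withDensity_rnDeriv_eq volume,
    _root_.add_apply,
    withDensityᵥ_apply ((derivMeasure hab hf).integrable_rnDeriv volume) measurableSet_Ico] at h1
  have h2 : (derivMeasure hab hf).singularPart volume (Ico a x) = 0 := by
    rw [← enorm_eq_zero, ← nonpos_iff_eq_zero]
    refine (SignedMeasure.enorm_apply_le_totalVariation _ measurableSet_Ico).trans ?_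
    exact (measure_mono (Ico_subset_Icc_self.trans (Icc_subset_Icc_right hx.2))).trans_eq hs
  rw [h2, zero_add, integral_Ico_eq_integral_Ioo, ← integral_Ioc_eq_integral_Ioo,
    ← intervalIntegral.integral_of_le hx.1] at h1
  rw [acDensity, h1]
  ring

theorem AbsolutelyContinuousOnInterval.congr {g : ℝ → ℝ}
    (hg : AbsolutelyContinuousOnInterval g a b) (h : EqOn f g (uIcc a b)) :
    AbsolutelyContinuousOnInterval f a b := by
  rw [absolutelyContinuousOnInterval_iff] at hg ⊢
  intro ε hε
  obtain ⟨δ, hδ, H⟩ := hg ε hε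
  refine ⟨δ, hδ, fun E hE hlen => ?_⟩
  refine (Finset.sum_congr rfl fun i hi => ?_).trans_lt (H E hE hlen)
  rw [h (hE.1 i hi).1, h (hE.1 i hi).2]

theorem absolutelyContinuousOnInterval_of_singularVariation_eq_zero (hab : a ≤ b)
    (hf : BoundedVariationOn f (Icc a b)) (hl : IsLeftContinuousOn f a b)
    (hs : singularVariation hab hf (Icc a b) = 0) : AbsolutelyContinuousOnInterval f a b := by
  have h1 := ((integrable_acDensity hab hf).intervalIntegrable
    (a := a) (b := b)).absolutelyContinuousOnInterval_intervalIntegral left_mem_uIcc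
  have h2 : AbsolutelyContinuousOnInterval (fun _ => f a) a b := by
    rw [absolutelyContinuousOnInterval_iff]
    exact fun ε hε => ⟨1, one_pos, fun _ _ _ => by simpa using hε⟩
  refine (h2.add h1).congr fun x hx => ?_
  rw [uIcc_of_le hab] at hx
  exact eq_add_integral_acDensity hab hf hl hs hx

theorem orliczModular_acDensity_eq (φ : ℝ≥0 → ℝ≥0∞) (hab : a ≤ b)
    (hf : BoundedVariationOn f (Icc a b)) (hl : IsLeftContinuousOn f a b)
    (hs : singularVariation hab hf (Icc a b) = 0) :
    orliczModular φ a b (acDensity hab hf) = orliczModular φ a b (deriv f) := by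
  rw [orliczModular, orliczModular, ← setLIntegral_congr Ioo_ae_eq_Icc,
    ← setLIntegral_congr Ioo_ae_eq_Icc]
  refine setLIntegral_congr_fun_ae measurableSet_Ioo ?_
  filter_upwards [((integrable_acDensity hab hf).intervalIntegrable
    (a := a) (b := b)).ae_hasDerivAt_integral] with x hx hxab
  have hd := ((hx (by rw [uIcc_of_le hab]; exact Ioo_subset_Icc_self hxab) a
    left_mem_uIcc).const_add (f a)).congr_of_eventuallyEq (f₁ := f) (by
      filter_upwards [Ioo_mem_nhds hxab.1 hxab.2] with y hy
      exact eq_add_integral_acDensity hab hf hl hs (Ioo_subset_Icc_self hy))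
  rw [hd.deriv]

end AbsolutelyContinuous

/-! ### The linear `Φ`-function and a jump -/

/-- The indicator function of the complement of `{a}`: a unit jump at `a`. -/
noncomputable def jumpAt (a : ℝ) : ℝ → ℝ := fun x => if x = a then 0 else 1

theorem isConvexPhi_coe : IsConvexPhi (fun t : ℝ≥0 => (t : ℝ≥0∞)) where
  mono := ENNReal.coe_mono
  map_zero := rfl
  tendsto_zero := (ENNReal.continuous_coe.tendsto' 0 0 rfl).mono_left nhdsWithin_le_nhds
  tendsto_atTop := ENNReal.tendsto_coe_nhds_top.2 tendsto_id
  almost_increasing := by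
    refine ⟨1, le_rfl, fun s t hs hst => ?_⟩
    rw [ENNReal.div_self (by exact_mod_cast hs.ne') ENNReal.coe_ne_top,
      ENNReal.div_self (by exact_mod_cast (hs.trans hst).ne') ENNReal.coe_ne_top]
    simp
  convex := ⟨convex_univ, fun x _ y _ p q _ _ _ => by simp [ENNReal.smul_def]⟩
  left_continuous := fun _ => ENNReal.continuous_coe.continuousWithinAt

theorem coe_notMem_inftyClass {p : ℝ} (hp : 1 < p) :
    (fun t : ℝ≥0 => (t : ℝ≥0∞)) ∉ inftyClass p := by
  rintro ⟨-, h⟩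
  obtain ⟨t, ht, ht1⟩ := ((h.eventually (lt_mem_nhds ENNReal.one_lt_top)).and
    (eventually_ge_atTop 1)).exists
  refine absurd ht (not_lt.2 (ENNReal.div_le_of_le_mul ?_))
  rw [one_mul, powPhi]
  refine (ENNReal.rpow_one (t : ℝ≥0∞)).symm.trans_le ?_
  exact ENNReal.rpow_le_rpow_of_exponent_le (by exact_mod_cast ht1) hp.le

theorem rieszVariation_coe_smul_jumpAt_le (a b c : ℝ) :
    rieszVariation (fun t : ℝ≥0 => (t : ℝ≥0∞)) a b (c • jumpAt a) ≤ ‖c‖ₑ := by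
  refine rieszVariation_le _ _ fun n u hu => ?_
  have hne : ∀ i < n, u (i + 1) ≠ a := fun i hi =>
    ((hu.mem_Icc hi.le).1.trans_lt (hu.2.2 i hi)).ne'
  rcases n with _ | n
  · simp [rieszSum]
  rw [rieszSum, Finset.sum_range_succ']
  rw [Finset.sum_eq_zero]
  · rw [zero_add, nnnorm_div_mul_ofReal _ (sub_pos.2 (hu.2.2 0 n.succ_pos))]
    simp [jumpAt, hu.1, hne 0 n.succ_pos]
  · intro i hi
    have hi' : i + 1 < n + 1 := by simpa using hi
    simp [jumpAt, hne i (by lia), hne (i + 1) hi']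

theorem jumpAt_mem_RBV_coe (a b : ℝ) : jumpAt a ∈ RBV (fun t : ℝ≥0 => (t : ℝ≥0∞)) a b := by
  refine tendsto_of_tendsto_of_tendsto_of_le_of_le tendsto_const_nhds ?_ (fun _ => zero_le)
    fun c => rieszVariation_coe_smul_jumpAt_le a b c
  exact (continuous_enorm.tendsto' (0 : ℝ) 0 enorm_zero).mono_left nhdsWithin_le_nhds

theorem jumpAt_notMem_RBV_powPhi {a b p : ℝ} (hab : a < b) (hp : 1 < p) :
    jumpAt a ∉ RBV (powPhi p) a b := by
  intro h
  have hlow : ∀ c : ℝ, c ≠ 0 → 1 ≤ rieszVariation (powPhi p) a b (c • jumpAt a) := by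
    intro c hc
    have hc' : 0 < |c| := abs_pos.2 hc
    -- on `[a, a + δ]` the sum is `|c| ^ p * δ ^ (1 - p)`, at least `1` for this choice of `δ`
    obtain ⟨δ, hδ, hδb, hδc⟩ : ∃ δ : ℝ, 0 < δ ∧ δ ≤ b - a ∧ δ ^ (p - 1) ≤ |c| ^ p := by
      refine ⟨min (b - a) (|c| ^ (p / (p - 1))), lt_min (sub_pos.2 hab) (by positivity),
        min_le_left _ _, ?_⟩
      calc min (b - a) (|c| ^ (p / (p - 1))) ^ (p - 1)
          ≤ (|c| ^ (p / (p - 1))) ^ (p - 1) :=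
            Real.rpow_le_rpow (le_min (sub_pos.2 hab).le (by positivity)) (min_le_right _ _)
              (by linarith)
        _ = |c| ^ p := by
            rw [← Real.rpow_mul hc'.le, div_mul_cancel₀ _ (by linarith)]
    have h1 := rieszVariation_add_le (powPhi p) (c • jumpAt a) (le_refl a)
      (show a < a + δ by linarith)
    refine le_trans ?_ ((le_add_self.trans h1).trans
      (rieszVariation_mono _ _ (by linarith) (by linarith)))
    have h2 : (c • jumpAt a) (a + δ) - (c • jumpAt a) a = c := by
      simp [jumpAt, hδ.ne']
    rw [h2, add_sub_cancel_left, powPhi, ← enorm_eq_nnnorm, Real.enorm_eq_ofReal_abs,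
      ENNReal.ofReal_rpow_of_nonneg (abs_nonneg _) (by linarith),
      ← ENNReal.ofReal_mul (by positivity), ← ENNReal.ofReal_one]
    refine ENNReal.ofReal_le_ofReal ?_
    rw [abs_div, abs_of_pos hδ, Real.div_rpow hc'.le hδ.le, div_mul_eq_mul_div,
      le_div_iff₀ (by positivity), one_mul]
    calc δ ^ p = δ ^ (p - 1) * δ := by
          rw [← Real.rpow_add_one hδ.ne', sub_add_cancel]
      _ ≤ |c| ^ p * δ := by gcongr
  have h0 := ge_of_tendsto h
    (eventually_nhdsWithin_of_forall fun c hc => hlow c hc)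
  simp at h0

theorem corollary1p4 :
    (∀ φ : ℝ≥0 → ℝ≥0∞, IsConvexPhi φ →
      ∃ K : ℝ≥0∞, Tendsto (fun t : ℝ≥0 => φ t / t) atTop (𝓝 K) ∧
        ∀ (a b : ℝ) (hab : a < b) (f : ℝ → ℝ), rieszVariation φ a b f < ∞ →
          (K < ∞ → IsLeftContinuousOn f a b →
            ∃ hf : BoundedVariationOn f (Icc a b),
              rieszVariation φ a b f =
                orliczModular φ a b (acDensity hab.le hf) +
                  K * singularVariation hab.le hf (Icc a b)) ∧
          (K = ∞ →
            AbsolutelyContinuousOnInterval f a b ∧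
              rieszVariation φ a b f = orliczModular φ a b (deriv f))) ∧
    -- the negative answer to the question of Appell, Banas and Merentes
    (∃ φ : ℝ≥0 → ℝ≥0∞, IsConvexPhi φ ∧ ∀ p : ℝ, 1 < p →
      φ ∉ inftyClass p ∧ ∀ a b : ℝ, a < b → RBV φ a b ≠ RBV (powPhi p) a b) := by
  refine ⟨fun φ hφ => ⟨_, hφ.tendsto_div_atTop, fun a b hab f hV => ?_⟩,
    _, isConvexPhi_coe, fun p hp => ⟨coe_notMem_inftyClass hp, fun a b hab heq => ?_⟩⟩
  · have hf := hφ.boundedVariationOn hV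
    refine ⟨fun _ hl => ⟨hf, hφ.rieszVariation_eq hab.le hf hl hV⟩, fun hK => ?_⟩
    have hl := hφ.isLeftContinuousOn hK hV
    have hs := hφ.singularVariation_eq_zero hK hab.le hf hV
    refine ⟨absolutelyContinuousOnInterval_of_singularVariation_eq_zero hab.le hf hl hs, ?_⟩
    rw [hφ.rieszVariation_eq hab.le hf hl hV, hs, mul_zero, add_zero,
      orliczModular_acDensity_eq φ hab.le hf hl hs]
  · exact jumpAt_notMem_RBV_powPhi hab hp (heq ▸ jumpAt_mem_RBV_coe a b)
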